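/- Let $\mathsf G$ be a turn-based stochastic game with finite state set $S = S_{\max}\sqcup S_{\min}$, finite action set $A$, non-empty sets $A(s)\subseteq A$ of available actions, and transition distributions $\delta(s,a)$ on $S$. Let $r:S\to\mathbb R_{\ge 0}$ be a reward function, $b>1$ and $\gamma>0$. A strategy maps every history $s_0a_0\dots s_n$ to a probability distribution on $A(s_n)$; it is memoryless deterministic (MD) if it is given by a function $\sigma:S\to A$ with $\sigma(s)\in A(s)$. Let $\Pi$ be the set of all strategies. In a profile $(\sigma,\tau)$ the Maximizer plays $\sigma$ in $S_{\max}$ and the Minimizer plays $\tau$ in $S_{\min}$; together with an initial state $s$ the profile induces a probability measure on plays $\rho=s_0a_0s_1a_1\dots$ with $s_0=s$. Let $\mathrm{TR}(\rho)=\sum_{i\ge 0} r(s_i)\in[0,\infty]$, and with $b^{-\infty}=0$ and $\log_b 0=-\infty$ put $$U_s(\sigma,\tau)=\mathbb E_s^{\sigma,\tau}\big[b^{-\gamma\,\mathrm{TR}}\big]\in[0,1],\qquad \mathrm{ERisk}_s(\sigma,\tau)=-\tfrac1\gamma\log_b U_s(\sigma,\tau)\in[0,\infty].$$ Then both games are determined: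 for every $s\in S$, $$\mathrm{ERisk}^*_s:=\sup_{\sigma\in\Pi}\inf_{\tau\in\Pi}\mathrm{ERisk}_s(\sigma,\tau)=\inf_{\tau\in\Pi}\sup_{\sigma\in\Pi}\mathrm{ERisk}_s(\sigma,\tau),\qquad U^*_s:=\inf_{\sigma\in\Pi}\sup_{\tau\in\Pi}U_s(\sigma,\tau)=\sup_{\tau\in\Pi}\inf_{\sigma\in\Pi}U_s(\sigma,\tau).$$ Moreover, there is an MD strategy $\sigma^*$ of the Maximizer such that for every $s\in S$ $$\mathrm{ERisk}^*_s=\inf_{\tau\in\Pi}\mathrm{ERisk}_s(\sigma^*,\tau)\quad\text{and}\quad U^*_s=\sup_{\tau\in\Pi}U_s(\sigma^*,\tau),$$ and there is an MD strategy $\tau^*$ of the Minimizer such that for every $s\in S$ $$\mathrm{ERisk}^*_s=\sup_{\sigma\in\Pi}\mathrm{ERisk}_s(\sigma,\tau^*)\quad\text{and}\quad U^*_s=\inf_{\sigma\in\Pi}U_s(\sigma,\tau^*).$$ -/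

import Mathlib

open MeasureTheory ProbabilityTheory
open scoped NNReal ENNReal

/-- The value `b ^ (-γ x)` for an extended nonnegative real `x`, with `b ^ (-∞) = 0`. -/
noncomputable def negExp (b γ : ℝ) (x : ℝ≥0∞) : ℝ≥0∞ :=
  open Classical in if x = ∞ then 0 else ENNReal.ofReal (b ^ (-γ * x.toReal))

/-- The logarithm to base `b`, as a map from `[0, ∞]` to `[-∞, ∞]`. -/
noncomputable def elogb (b : ℝ) (u : ℝ≥0∞) : EReal :=
  ENNReal.log u / ((Real.log b : ℝ) : EReal)

/-- The negative exponential utility `E[b ^ (-γ X)]` of a `[0, ∞]`-valued random variable. -/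
noncomputable def negExpUtility {Ω : Type*} [MeasurableSpace Ω] (μ : Measure Ω) (b γ : ℝ)
    (X : Ω → ℝ≥0∞) : ℝ≥0∞ :=
  ∫⁻ ω, negExp b γ (X ω) ∂μ

/-- The entropic risk `-(1/γ) log_b E[b ^ (-γ X)]` of a `[0, ∞]`-valued random variable. -/
noncomputable def entropicRisk {Ω : Type*} [MeasurableSpace Ω] (μ : Measure Ω) (b γ : ℝ)
    (X : Ω → ℝ≥0∞) : EReal :=
  ((-(1 / γ) : ℝ) : EReal) * elogb b (negExpUtility μ b γ X)

/-- A turn-based stochastic game with state set `S` and action set `A`. The states outside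
`maxStates` belong to Minimizer. The values of `trans s a` for `a ∉ avail s` are irrelevant. -/
structure StochasticGame (S A : Type*) where
  maxStates : Set S
  avail : S → Set A
  avail_nonempty : ∀ s, (avail s).Nonempty
  trans : S → A → PMF S

namespace StochasticGame

/-- A history-dependent randomized strategy. A history `s₀ a₀ … sₙ₋₁ aₙ₋₁ sₙ` is given as
the list `[(s₀, a₀), …, (sₙ₋₁, aₙ₋₁)]` together with the current state `sₙ`. (Values on lists
which are not consistent with the game have no influence on the distribution of plays.) -/
structure Strategy {S A : Type*} (G : StochasticGame S A) where
  dist : List (S × A) → S → PMF A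
  support_subset : ∀ h s, (dist h s).support ⊆ G.avail s

/-- A memoryless deterministic strategy. -/
structure MDStrategy {S A : Type*} (G : StochasticGame S A) where
  act : S → A
  act_mem : ∀ s, act s ∈ G.avail s

/-- A memoryless deterministic strategy, as a strategy. -/
noncomputable def MDStrategy.toStrategy {S A : Type*} {G : StochasticGame S A}
    (σ : G.MDStrategy) : G.Strategy where
  dist _ s := PMF.pure (σ.act s)
  support_subset h s := by
    intro a ha
    rw [PMF.mem_support_pure_iff] at ha
    exact ha ▸ σ.act_mem s

/-- The joint strategy of a profile: `σ` decides in Maximizer states, `τ` in Minimizer states. -/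
noncomputable def joint {S A : Type*} {G : StochasticGame S A} (σ τ : G.Strategy) :
    G.Strategy where
  dist h s := open Classical in if s ∈ G.maxStates then σ.dist h s else τ.dist h s
  support_subset h s := by
    split_ifs
    · exact σ.support_subset h s
    · exact τ.support_subset h s

/-- After the history `h` ending in state `s`, the distribution of `(s, a)`, where the action `a`
is drawn by the joint strategy `π`. -/
noncomputable def Strategy.pairDist {S A : Type*} {G : StochasticGame S A} (π : G.Strategy)
    (h : List (S × A)) (s : S) : PMF (S × A) :=
  (π.dist h s).map fun a => (s, a)

/-- One step of the play under the joint strategy `π`: given `(s₀, a₀), …, (sₙ, aₙ)`, draw `sₙ₊₁`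
from `trans sₙ aₙ` and then `aₙ₊₁` from `π`. -/
noncomputable def Strategy.stepDist {S A : Type*} {G : StochasticGame S A} (π : G.Strategy)
    (n : ℕ) (x : (i : Finset.Iic n) → S × A) : PMF (S × A) :=
  let last := x ⟨n, Finset.mem_Iic.2 le_rfl⟩
  let h := List.ofFn fun i : Fin (n + 1) => x ⟨i, Finset.mem_Iic.2 (Nat.le_of_lt_succ i.2)⟩
  (G.trans last.1 last.2).bind fun s' => π.pairDist h s'

section Plays

variable {S A : Type*} [Finite S] [Finite A]
  [MeasurableSpace S] [DiscreteMeasurableSpace S] [MeasurableSpace A] [DiscreteMeasurableSpace A]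

/-- `Strategy.stepDist` as a Markov kernel. -/
noncomputable def Strategy.stepKernel {G : StochasticGame S A} (π : G.Strategy) (n : ℕ) :
    Kernel ((i : Finset.Iic n) → S × A) (S × A) :=
  Kernel.ofFunOfCountable fun x => (π.stepDist n x).toMeasure

instance Strategy.isMarkovKernel_stepKernel {G : StochasticGame S A} (π : G.Strategy) (n : ℕ) :
    IsMarkovKernel (π.stepKernel n) :=
  ⟨fun x => PMF.toMeasure.isProbabilityMeasure (π.stepDist n x)⟩

/-- The distribution of the play `s₀ a₀ s₁ a₁ …` with `s₀ = s` under the joint strategy `π`. -/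
noncomputable def playMeasure {G : StochasticGame S A} (π : G.Strategy) (s : S) :
    Measure (ℕ → S × A) :=
  Kernel.trajMeasure (X := fun _ => S × A) (π.pairDist [] s).toMeasure π.stepKernel

/-- The total reward of a play; the reward of the initial state counts. -/
noncomputable def totalReward {S A : Type*} (r : S → ℝ≥0) (ρ : ℕ → S × A) : ℝ≥0∞ :=
  ∑' i, (r (ρ i).1 : ℝ≥0∞)

/-- Negative exponential utility of the total reward under the profile `(σ, τ)` from `s`. -/
noncomputable def utility (G : StochasticGame S A) (r : S → ℝ≥0) (b γ : ℝ)
    (σ τ : G.Strategy) (s : S) : ℝ≥0∞ :=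
  negExpUtility (playMeasure (joint σ τ) s) b γ (totalReward r)

/-- Entropic risk of the total reward under the profile `(σ, τ)` from `s`. -/
noncomputable def eRisk (G : StochasticGame S A) (r : S → ℝ≥0) (b γ : ℝ)
    (σ τ : G.Strategy) (s : S) : EReal :=
  entropicRisk (playMeasure (joint σ τ) s) b γ (totalReward r)

/-- The optimal negative exponential utility (which Maximizer, choosing `σ`, minimizes). -/
noncomputable def optUtility (G : StochasticGame S A) (r : S → ℝ≥0) (b γ : ℝ) (s : S) : ℝ≥0∞ :=
  ⨅ σ : G.Strategy, ⨆ τ : G.Strategy, G.utility r b γ σ τ s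

/-- The optimal entropic risk. -/
noncomputable def optERisk (G : StochasticGame S A) (r : S → ℝ≥0) (b γ : ℝ) (s : S) : EReal :=
  ⨆ σ : G.Strategy, ⨅ τ : G.Strategy, G.eRisk r b γ σ τ s

end Plays

end StochasticGame

/-!
Write `d s = b ^ (-γ r(s)) ≤ 1`. The utility of a profile is the expectation of the infinite product
of the weights `d` of the visited states, hence the infimum over `n` of the expectations of the
first `n` factors (`utility_eq_iInf`). Reading `d s` as a survival probability, Maximizer plays a
reachability game and Minimizer the dual safety game, with optimality equation
`v s = d s * opt_a ∑ s', δ(s, a)(s') v s'`, where `opt` is `min` for Maximizer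
and `max` for Minimizer.

For the safety player, every selector of optimal actions for a solution `v ≤ 1` guarantees `v`, by
a submartingale argument (`le_lintegral_weight`). For the reachability player this fails, since such
a selector may postpone progress forever. The remedy is to stop the play with survival with
probability `α` before every transition, which changes the equation into
`v s = d s * (α + (1 - α) * opt_a ∑ s', δ(s, a)(s') v s')`. If `α > 0`, the optimal selectors of the
reachability player guarantee a solution `v_α` of this equation, even as an upper bound for the
utility of the original game (`iInf_lintegral_weight_le`). As there are finitely many selectors, one
selector `c` is optimal for values of `α` arbitrarily close to `0`, along which `v_α` converges to
some `v` by compactness (`exists_limit_isOptimalPair`). Then `v` solves the original equation, with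
`c` as a selector for both players. Played by both of them, `c` is a saddle point of the utility with
value `v` (`exists_utility_saddle`); since entropic risk is a decreasing function of utility, it is
also a saddle point of the risk.
-/

open Filter Topology

/-! ### Expectations under probability mass functions -/

namespace PMF

variable {α β : Type*}

theorem lintegral_toMeasure [Countable α] [MeasurableSpace α] [MeasurableSingletonClass α]
    (p : PMF α) (f : α → ℝ≥0∞) : ∫⁻ a, f a ∂p.toMeasure = ∑' a, p a * f a := by
  rw [lintegral_countable']
  exact tsum_congr fun a => by
    rw [p.toMeasure_apply_singleton a (measurableSet_singleton a), mul_comm]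

theorem tsum_bind_mul (p : PMF α) (q : α → PMF β) (f : β → ℝ≥0∞) :
    ∑' b, p.bind q b * f b = ∑' a, p a * ∑' b, q a b * f b := by
  simp_rw [bind_apply, ← ENNReal.tsum_mul_right, ← ENNReal.tsum_mul_left]
  rw [ENNReal.tsum_comm]
  simp_rw [mul_assoc]

theorem tsum_map_mul (p : PMF α) (g : α → β) (f : β → ℝ≥0∞) :
    ∑' b, p.map g b * f b = ∑' a, p a * f (g a) := by
  rw [← bind_pure_comp, tsum_bind_mul]
  refine tsum_congr fun a => ?_
  rw [tsum_eq_single (g a) fun b hb => by simp [hb]]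
  simp

theorem le_tsum_mul (p : PMF α) {f : α → ℝ≥0∞} {c : ℝ≥0∞} (h : ∀ a ∈ p.support, c ≤ f a) :
    c ≤ ∑' a, p a * f a := by
  calc c = ∑' a, p a * c := by rw [ENNReal.tsum_mul_right, p.tsum_coe, one_mul]
    _ ≤ _ := ENNReal.tsum_le_tsum fun a => by
      by_cases ha : p a = 0
      · simp [ha]
      · gcongr
        exact h a ((p.mem_support_iff a).2 ha)

theorem tsum_mul_le (p : PMF α) {f : α → ℝ≥0∞} {c : ℝ≥0∞} (h : ∀ a ∈ p.support, f a ≤ c) :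
    ∑' a, p a * f a ≤ c := by
  calc ∑' a, p a * f a ≤ ∑' a, p a * c := ENNReal.tsum_le_tsum fun a => by
        by_cases ha : p a = 0
        · simp [ha]
        · gcongr
          exact h a ((p.mem_support_iff a).2 ha)
    _ = c := by rw [ENNReal.tsum_mul_right, p.tsum_coe, one_mul]

end PMF

/-! ### The exponential utility as an infinite product -/

section NegExp

variable {b γ : ℝ}

theorem negExp_coe (x : ℝ≥0) : negExp b γ x = ENNReal.ofReal (b ^ (-γ * x)) := by
  simp [negExp]

theorem negExp_coe_le_one (hb : 1 < b) (hγ : 0 < γ) (x : ℝ≥0) : negExp b γ x ≤ 1 := by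
  rw [negExp_coe]
  exact ENNReal.ofReal_le_one.2
    (Real.rpow_le_one_of_one_le_of_nonpos hb.le (by have := mul_nonneg hγ.le x.2; simpa using this))

theorem negExp_sum (hb : 1 < b) (r : ℕ → ℝ≥0) (n : ℕ) :
    negExp b γ (∑ i ∈ Finset.range n, (r i : ℝ≥0∞)) =
      ∏ i ∈ Finset.range n, negExp b γ (r i) := by
  have hb0 : 0 < b := one_pos.trans hb
  rw [← ENNReal.ofNNReal_finsetSum]
  simp_rw [negExp_coe]
  rw [← ENNReal.ofReal_prod_of_nonneg fun i _ => (Real.rpow_pos_of_pos hb0 _).le,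
    ← Real.rpow_sum_of_pos hb0, NNReal.coe_sum, Finset.mul_sum]

theorem tendsto_negExp_tsum (hb : 1 < b) (hγ : 0 < γ) (r : ℕ → ℝ≥0) :
    Tendsto (fun n => negExp b γ (∑ i ∈ Finset.range n, (r i : ℝ≥0∞))) atTop
      (𝓝 (negExp b γ (∑' i, (r i : ℝ≥0∞)))) := by
  have hb0 : 0 < b := one_pos.trans hb
  simp_rw [← ENNReal.ofNNReal_finsetSum, negExp_coe]
  by_cases h : Summable r
  · rw [← ENNReal.coe_tsum h, negExp_coe]
    refine ENNReal.tendsto_ofReal (Tendsto.rpow tendsto_const_nhds ?_ (Or.inl hb0.ne'))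
    exact (NNReal.tendsto_coe.2 h.hasSum.tendsto_sum_nat).const_mul _
  · have htop : ∑' i, (r i : ℝ≥0∞) = ∞ := by
      by_contra hne
      exact h (ENNReal.tsum_coe_ne_top_iff_summable.1 hne)
    have hlim : Tendsto (fun n => ((∑ i ∈ Finset.range n, r i : ℝ≥0) : ℝ)) atTop atTop := by
      refine NNReal.tendsto_coe_atTop.2 (ENNReal.tendsto_coe_nhds_top.1 ?_)
      have := ENNReal.tendsto_nat_tsum fun i => (r i : ℝ≥0∞)
      rw [htop] at this
      simpa only [ENNReal.ofNNReal_finsetSum] using this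
    rw [htop, negExp, if_pos rfl, ← ENNReal.ofReal_zero]
    refine ENNReal.tendsto_ofReal ?_
    have hneg : Tendsto (fun n => -γ * ((∑ i ∈ Finset.range n, r i : ℝ≥0) : ℝ)) atTop atBot :=
      hlim.const_mul_atTop_of_neg (neg_lt_zero.2 hγ)
    exact (tendsto_rpow_atBot_of_base_gt_one b hb).comp hneg

theorem negExp_tsum (hb : 1 < b) (hγ : 0 < γ) (r : ℕ → ℝ≥0) :
    negExp b γ (∑' i, (r i : ℝ≥0∞)) = ⨅ n, ∏ i ∈ Finset.range n, negExp b γ (r i) := by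
  have h := tendsto_negExp_tsum hb hγ r
  simp_rw [negExp_sum hb] at h
  exact tendsto_nhds_unique h (tendsto_atTop_iInf (antitone_nat_of_succ_le fun n => by
    rw [Finset.prod_range_succ]
    exact mul_le_of_le_one_right' (negExp_coe_le_one hb hγ _)))

/-- Entropic risk depends on the law only through the utility, in a decreasing way. -/
theorem antitone_risk_of_utility (hb : 1 < b) (hγ : 0 < γ) :
    Antitone fun u : ℝ≥0∞ => ((-(1 / γ) : ℝ) : EReal) * elogb b u := by
  intro u v huv
  have h1 : elogb b u ≤ elogb b v :=
    EReal.div_le_div_right_of_nonneg (EReal.coe_nonneg.2 (Real.log_pos hb).le)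
      (ENNReal.log_monotone huv)
  have h2 : ((-(1 / γ) : ℝ) : EReal) ≤ 0 :=
    EReal.coe_nonpos.2 (neg_nonpos.2 (one_div_pos.2 hγ).le)
  simp only [mul_comm ((-(1 / γ) : ℝ) : EReal)]
  exact EReal.mul_le_mul_of_nonpos_right h1 h2

end NegExp

namespace StochasticGame

/-! ### The one-step law of a play -/

section OneStep

variable {S A : Type*} {G : StochasticGame S A}

/-- The expectation of `v` in the successor state of the state-action pair `x`. -/
noncomputable def nextValue (G : StochasticGame S A) (v : S → ℝ≥0∞) (x : S × A) : ℝ≥0∞ :=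
  ∑' s, G.trans x.1 x.2 s * v s

theorem nextValue_mono {v w : S → ℝ≥0∞} (h : v ≤ w) (x : S × A) :
    G.nextValue v x ≤ G.nextValue w x :=
  ENNReal.tsum_le_tsum fun s => by gcongr; exact h s

theorem nextValue_le {v : S → ℝ≥0∞} {c : ℝ≥0∞} (h : ∀ s, v s ≤ c) (x : S × A) :
    G.nextValue v x ≤ c :=
  PMF.tsum_mul_le _ fun s _ => h s

theorem Strategy.tsum_pairDist_mul (π : G.Strategy) (h : List (S × A)) (s : S)
    (V : S × A → ℝ≥0∞) :
    ∑' x, π.pairDist h s x * V x = ∑' a, π.dist h s a * V (s, a) :=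
  PMF.tsum_map_mul _ _ _

/-- Every action chosen by `π` with positive probability satisfies `P`. -/
def Strategy.Plays (π : G.Strategy) (P : S → A → Prop) : Prop :=
  ∀ h s, ∀ a ∈ (π.dist h s).support, P s a

/-- The product of the weights `d` of the first `n` states of a play. -/
noncomputable def weight (d : S → ℝ≥0∞) (n : ℕ) (ρ : ℕ → S × A) : ℝ≥0∞ :=
  ∏ i ∈ Finset.range n, d (ρ i).1

theorem weight_succ (d : S → ℝ≥0∞) (n : ℕ) (ρ : ℕ → S × A) :
    weight d (n + 1) ρ = weight d n ρ * d (ρ n).1 :=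
  Finset.prod_range_succ _ _

theorem measurable_weight [MeasurableSpace S] [DiscreteMeasurableSpace S] [MeasurableSpace A]
    (d : S → ℝ≥0∞) (n : ℕ) :
    Measurable (weight d n : (ℕ → S × A) → ℝ≥0∞) := by
  have hd : Measurable d := .of_discrete
  unfold weight
  fun_prop

/-- The product of the weights `d` of the states of an initial segment of a play. -/
noncomputable def segmentWeight (d : S → ℝ≥0∞) {n : ℕ} (x : (i : Finset.Iic n) → S × A) : ℝ≥0∞ :=
  ∏ i : Fin (n + 1), d (x ⟨i, Finset.mem_Iic.2 (Nat.le_of_lt_succ i.2)⟩).1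

theorem weight_eq_segmentWeight (d : S → ℝ≥0∞) (n : ℕ) (ρ : ℕ → S × A) :
    weight d (n + 1) ρ = segmentWeight d (Preorder.frestrictLe n ρ) :=
  (Fin.prod_univ_eq_prod_range (fun i => d (ρ i).1) (n + 1)).symm

variable [Finite S] [Finite A] [MeasurableSpace S] [DiscreteMeasurableSpace S]
  [MeasurableSpace A] [DiscreteMeasurableSpace A]

instance isProbabilityMeasure_playMeasure (π : G.Strategy) (s : S) :
    IsProbabilityMeasure (playMeasure π s) := by
  have := PMF.toMeasure.isProbabilityMeasure (π.pairDist [] s)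
  unfold playMeasure
  infer_instance

theorem lintegral_playMeasure_zero (π : G.Strategy) (s : S) (V : S × A → ℝ≥0∞) :
    ∫⁻ ρ, V (ρ 0) ∂playMeasure π s = ∑' a, π.dist [] s a * V (s, a) := by
  have := PMF.toMeasure.isProbabilityMeasure (π.pairDist [] s)
  have key : (playMeasure π s).map (Preorder.frestrictLe 0) =
      (π.pairDist [] s).toMeasure.map
        (MeasurableEquiv.piUnique fun _ : Finset.Iic 0 => S × A).symm := by
    rw [playMeasure, Kernel.trajMeasure, Measure.map_comp _ _ (by fun_prop),
      Kernel.traj_map_frestrictLe, Kernel.partialTraj_self, Measure.id_comp]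
  let W : ((i : Finset.Iic 0) → S × A) → ℝ≥0∞ := fun x => V (x ⟨0, Finset.mem_Iic.2 le_rfl⟩)
  have hW : Measurable W := .of_discrete
  have h1 : ∫⁻ ρ, V (ρ 0) ∂playMeasure π s =
      ∫⁻ x, W x ∂(playMeasure π s).map (Preorder.frestrictLe 0) := by
    rw [lintegral_map hW (by fun_prop)]
    rfl
  rw [h1, key, lintegral_map hW (by fun_prop), ← π.tsum_pairDist_mul, ← PMF.lintegral_toMeasure]
  rfl

/-- The history along which `Strategy.stepDist` calls the strategy. -/
def historyOf {n : ℕ} (x : (i : Finset.Iic n) → S × A) : List (S × A) :=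
  List.ofFn fun i : Fin (n + 1) => x ⟨i, Finset.mem_Iic.2 (Nat.le_of_lt_succ i.2)⟩

theorem lintegral_playMeasure_succ (π : G.Strategy) (s : S) (n : ℕ)
    (w : ((i : Finset.Iic n) → S × A) → ℝ≥0∞) (V : S × A → ℝ≥0∞) :
    ∫⁻ ρ, w (Preorder.frestrictLe n ρ) * V (ρ (n + 1)) ∂playMeasure π s =
      ∫⁻ ρ, w (Preorder.frestrictLe n ρ) * G.nextValue (fun s' =>
        ∑' a, π.dist (historyOf (Preorder.frestrictLe n ρ)) s' a * V (s', a)) (ρ n)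
        ∂playMeasure π s := by
  have := PMF.toMeasure.isProbabilityMeasure (π.pairDist [] s)
  let F : ((i : Finset.Iic n) → S × A) × (S × A) → ℝ≥0∞ := fun p => w p.1 * V p.2
  have hF : Measurable F := .of_discrete
  let H : ((i : Finset.Iic n) → S × A) → ℝ≥0∞ := fun x => w x * G.nextValue (fun s' =>
    ∑' a, π.dist (historyOf x) s' a * V (s', a)) (x ⟨n, Finset.mem_Iic.2 le_rfl⟩)
  have hH : Measurable H := .of_discrete
  have hV : Measurable V := .of_discrete
  have h1 : ∫⁻ ρ, w (Preorder.frestrictLe n ρ) * V (ρ (n + 1)) ∂playMeasure π s =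
      ∫⁻ p, F p ∂(playMeasure π s).map fun ρ => (Preorder.frestrictLe n ρ, ρ (n + 1)) := by
    rw [lintegral_map hF (by fun_prop)]
  have h2 : (playMeasure π s).map (fun ρ => (Preorder.frestrictLe n ρ, ρ (n + 1))) =
      (playMeasure π s).map (Preorder.frestrictLe n) ⊗ₘ π.stepKernel n :=
    Kernel.map_frestrictLe_trajMeasure_compProd_eq_map_trajMeasure.symm
  have h3 (x) : ∫⁻ y, F (x, y) ∂π.stepKernel n x = H x := by
    have : π.stepKernel n x = (π.stepDist n x).toMeasure := rfl
    simp only [F, H]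
    rw [lintegral_const_mul _ hV, this, PMF.lintegral_toMeasure]
    simp only [Strategy.stepDist, PMF.tsum_bind_mul, Strategy.tsum_pairDist_mul]
    rfl
  rw [h1, h2, Measure.lintegral_compProd hF]
  simp_rw [h3]
  rw [lintegral_map hH (by fun_prop)]
  rfl

/-! ### Bounds on the expected weight of a play -/

theorem lintegral_weight_mul_nextValue_le {π : G.Strategy} (d v : S → ℝ≥0∞) {V : S × A → ℝ≥0∞}
    (hπ : π.Plays fun s a => v s ≤ V (s, a)) (s : S) (n : ℕ) :
    ∫⁻ ρ, weight d (n + 1) ρ * G.nextValue v (ρ n) ∂playMeasure π s ≤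
      ∫⁻ ρ, weight d (n + 1) ρ * V (ρ (n + 1)) ∂playMeasure π s := by
  simp_rw [weight_eq_segmentWeight]
  rw [lintegral_playMeasure_succ]
  gcongr with ρ
  exact nextValue_mono (fun s' => PMF.le_tsum_mul _ (hπ _ _)) _

theorem lintegral_weight_mul_le_nextValue {π : G.Strategy} (d v : S → ℝ≥0∞) {V : S × A → ℝ≥0∞}
    (hπ : π.Plays fun s a => V (s, a) ≤ v s) (s : S) (n : ℕ) :
    ∫⁻ ρ, weight d (n + 1) ρ * V (ρ (n + 1)) ∂playMeasure π s ≤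
      ∫⁻ ρ, weight d (n + 1) ρ * G.nextValue v (ρ n) ∂playMeasure π s := by
  simp_rw [weight_eq_segmentWeight]
  rw [lintegral_playMeasure_succ]
  gcongr with ρ
  exact nextValue_mono (fun s' => PMF.tsum_mul_le _ (hπ _ _)) _

/-- Suppose that `v ≤ 1` and that `v s ≤ d s * nextValue v (s, a)` for every action that `π` can
take. Then `weight d (n + 1) ρ * nextValue v (ρ n)` is a submartingale which is bounded by
`weight d n ρ`, so that `v` is a lower bound for the expected weights. -/
theorem le_lintegral_weight {π : G.Strategy} {d v : S → ℝ≥0∞} (hd : ∀ s, d s ≤ 1)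
    (hv : ∀ s, v s ≤ 1) (hπ : π.Plays fun s a => v s ≤ d s * G.nextValue v (s, a)) (s : S)
    (n : ℕ) : v s ≤ ∫⁻ ρ, weight d n ρ ∂playMeasure π s := by
  have key : ∀ n, v s ≤ ∫⁻ ρ, weight d (n + 1) ρ * G.nextValue v (ρ n) ∂playMeasure π s := by
    intro n
    induction n with
    | zero =>
      simp only [weight, zero_add, Finset.prod_range_one]
      rw [lintegral_playMeasure_zero π s fun x => d x.1 * G.nextValue v x]
      exact PMF.le_tsum_mul _ (hπ _ _)
    | succ n ih =>
      refine ih.trans ((lintegral_weight_mul_nextValue_le d v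
        (V := fun x => d x.1 * G.nextValue v x) hπ s n).trans_eq ?_)
      simp_rw [weight_succ d (n + 1), mul_assoc]
  refine (key n).trans (lintegral_mono fun ρ => ?_)
  rw [weight_succ, mul_assoc]
  exact mul_le_of_le_one_right' (mul_le_one' (hd _) (nextValue_le hv _))

/-- A supersolution `v` is an upper bound for the expected weight of the play, provided that every
transition is preceded by the option of stopping with probability `α ≠ 0`. For `α = 0` this fails:
if all weights are `1`, then `v = 0` is a supersolution, but the expected weight is `1`. -/
theorem iInf_lintegral_weight_le {π : G.Strategy} {d v : S → ℝ≥0∞} {α β : ℝ≥0∞}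
    (hα : α ≠ 0) (hαβ : α + β = 1) (hv : ∀ s, v s ≤ 1)
    (hπ : π.Plays fun s a => d s * (α + β * G.nextValue v (s, a)) ≤ v s) (s : S) :
    ⨅ n, ∫⁻ ρ, weight d n ρ ∂playMeasure π s ≤ v s := by
  set u := ⨅ n, ∫⁻ ρ, weight d n ρ ∂playMeasure π s with hu
  have hα' : α ≠ ∞ := ((le_add_right le_rfl).trans_eq hαβ).trans_lt ENNReal.one_lt_top |>.ne
  have hβ' : β ≠ ∞ := ((le_add_left le_rfl).trans_eq hαβ).trans_lt ENNReal.one_lt_top |>.ne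
  have hmeas (n) : Measurable fun ρ : ℕ → S × A => weight d (n + 1) ρ * G.nextValue v (ρ n) :=
    (measurable_weight d _).mul
      ((Measurable.of_discrete (f := G.nextValue v)).comp (measurable_pi_apply n))
  -- `z n` is the value of stopping or going on at time `n`
  set z : ℕ → ℝ≥0∞ := fun n =>
    ∫⁻ ρ, weight d (n + 1) ρ * (α + β * G.nextValue v (ρ n)) ∂playMeasure π s with hz
  have hz0 : z 0 ≤ v s := by
    simp only [hz, weight, zero_add, Finset.prod_range_one]
    rw [lintegral_playMeasure_zero π s fun x => d x.1 * (α + β * G.nextValue v x)]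
    exact PMF.tsum_mul_le _ (hπ _ _)
  have hstep (n) : α * u + β * z (n + 1) ≤ z n := by
    have hsplit : z n = α * ∫⁻ ρ, weight d (n + 1) ρ ∂playMeasure π s +
        β * ∫⁻ ρ, weight d (n + 1) ρ * G.nextValue v (ρ n) ∂playMeasure π s := by
      rw [← lintegral_const_mul _ (measurable_weight d _), ← lintegral_const_mul _ (hmeas n),
        ← lintegral_add_left ((measurable_weight d _).const_mul _)]
      exact lintegral_congr fun ρ => by ring
    rw [hsplit]
    gcongr
    · exact iInf_le _ _
    · refine le_trans (le_of_eq ?_) (lintegral_weight_mul_le_nextValue d v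
        (V := fun x => d x.1 * (α + β * G.nextValue v x)) hπ s n)
      simp_rw [hz, weight_succ d (n + 1), mul_assoc]
  have hfin : (⨅ n, z n) ≠ ∞ :=
    ((iInf_le z 0).trans (hz0.trans (hv s))).trans_lt ENNReal.one_lt_top |>.ne
  -- the infimum of `z` satisfies `α * u + β * inf z ≤ inf z = α * inf z + β * inf z`; as it is
  -- finite, the terms with `β` and then the factor `α` cancel
  have hlim : α * u + β * ⨅ n, z n ≤ α * (⨅ n, z n) + β * ⨅ n, z n := by
    rw [← add_mul, hαβ, one_mul]
    refine le_iInf fun n => le_trans ?_ (hstep n)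
    gcongr
    exact iInf_le _ _
  have h := (ENNReal.mul_le_mul_iff_right hα hα').1
    ((ENNReal.add_le_add_iff_right (ENNReal.mul_ne_top hβ' hfin)).1 hlim)
  exact h.trans ((iInf_le z 0).trans hz0)

theorem utility_eq_iInf {r : S → ℝ≥0} {b γ : ℝ} (hb : 1 < b) (hγ : 0 < γ) (σ τ : G.Strategy)
    (s : S) : G.utility r b γ σ τ s =
      ⨅ n, ∫⁻ ρ, weight (fun s => negExp b γ (r s)) n ρ ∂playMeasure (joint σ τ) s := by
  rw [← lintegral_iInf (fun n => measurable_weight _ n) ?_ (by simp [weight])]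
  · exact lintegral_congr fun ρ => by simp only [totalReward, negExp_tsum hb hγ]; rfl
  · refine antitone_nat_of_succ_le fun n ρ => ?_
    rw [weight_succ]
    exact mul_le_of_le_one_right' (negExp_coe_le_one hb hγ _)

end OneStep

/-! ### Discounted optimality equations and their limit -/

section Optimality

variable {S A : Type*} {G : StochasticGame S A}

theorem tendsto_nextValue [Finite S] {ι : Type*} {l : Filter ι} {v : ι → S → ℝ≥0∞}
    {w : S → ℝ≥0∞} (h : Tendsto v l (𝓝 w)) (x : S × A) :
    Tendsto (fun i => G.nextValue (v i) x) l (𝓝 (G.nextValue w x)) := by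
  have := Fintype.ofFinite S
  simp only [nextValue, tsum_fintype]
  exact tendsto_finsetSum _ fun s _ =>
    ENNReal.Tendsto.const_mul (tendsto_pi_nhds.1 h s) (Or.inr (PMF.apply_ne_top _ _))

variable [Finite A]

instance finite_mdStrategy [Finite S] : Finite G.MDStrategy :=
  Finite.of_injective MDStrategy.act fun σ τ h => by
    cases σ; cases τ; cases h; rfl

/-- `v` solves the optimality equation `v s = d s * (α + β * opt)`, where `opt` is the least (in
the states of Maximizer) or the greatest (in the other states) value of `nextValue v (s, a)`, and
`c` selects an action at which the optimum is attained. -/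
structure IsOptimalPair (G : StochasticGame S A) (d : S → ℝ≥0∞) (α β : ℝ≥0∞) (v : S → ℝ≥0∞)
    (c : G.MDStrategy) : Prop where
  le_one : ∀ s, v s ≤ 1
  eq : ∀ s, v s = d s * (α + β * G.nextValue v (s, c.act s))
  le : ∀ s ∈ G.maxStates, ∀ a ∈ G.avail s, v s ≤ d s * (α + β * G.nextValue v (s, a))
  ge : ∀ s ∉ G.maxStates, ∀ a ∈ G.avail s, d s * (α + β * G.nextValue v (s, a)) ≤ v s

theorem exists_isOptimalPair {d : S → ℝ≥0∞} (hd : ∀ s, d s ≤ 1) {α β : ℝ≥0∞}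
    (hαβ : α + β = 1) : ∃ v c, IsOptimalPair G d α β v c := by
  classical
  let opt (v : S → ℝ≥0∞) (s : S) : ℝ≥0∞ :=
    if s ∈ G.maxStates then ⨅ a ∈ G.avail s, d s * (α + β * G.nextValue v (s, a))
    else ⨆ a ∈ G.avail s, d s * (α + β * G.nextValue v (s, a))
  have hmono : Monotone opt := fun v w h s => by
    simp only [opt]
    split_ifs
    · exact iInf₂_mono fun a _ => by gcongr; exact nextValue_mono h _
    · exact iSup₂_mono fun a _ => by gcongr; exact nextValue_mono h _
  have hsel (v : S → ℝ≥0∞) (s : S) :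
      ∃ a ∈ G.avail s, opt v s = d s * (α + β * G.nextValue v (s, a)) := by
    by_cases hs : s ∈ G.maxStates
    · obtain ⟨a, ha, hmin⟩ := Set.exists_min_image (G.avail s)
        (fun a => d s * (α + β * G.nextValue v (s, a))) (Set.toFinite _) (G.avail_nonempty s)
      refine ⟨a, ha, ?_⟩
      simp only [opt, if_pos hs]
      exact le_antisymm (iInf₂_le a ha) (le_iInf₂ hmin)
    · obtain ⟨a, ha, hmax⟩ := Set.exists_max_image (G.avail s)
        (fun a => d s * (α + β * G.nextValue v (s, a))) (Set.toFinite _) (G.avail_nonempty s)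
      refine ⟨a, ha, ?_⟩
      simp only [opt, if_neg hs]
      exact le_antisymm (iSup₂_le hmax) (le_iSup₂_of_le a ha le_rfl)
  -- any fixed point below `1` will do; the least one is below `1` because `opt 1 ≤ 1`
  let T : (S → ℝ≥0∞) →o (S → ℝ≥0∞) := ⟨opt, hmono⟩
  have hfix : opt T.lfp = T.lfp := T.map_lfp
  have hone : T.lfp ≤ 1 := T.lfp_le fun s => by
    obtain ⟨a, -, h⟩ := hsel 1 s
    refine h.trans_le (mul_le_one' (hd s) ?_)
    refine le_trans ?_ hαβ.le
    gcongr
    exact mul_le_of_le_one_right' (nextValue_le (fun _ => le_rfl) _)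
  choose c hc hcv using hsel T.lfp
  refine ⟨T.lfp, ⟨c, hc⟩, hone, fun s => ?_, fun s hs a ha => ?_, fun s hs a ha => ?_⟩
  · rw [← hcv s, hfix]
  · conv_lhs => rw [← hfix]
    simp only [opt, if_pos hs]
    exact iInf₂_le a ha
  · conv_rhs => rw [← hfix]
    simp only [opt, if_neg hs]
    exact le_iSup₂_of_le a ha le_rfl

/-- Letting the stopping probability `α` tend to `0`, some selector `c` is optimal for stopping
probabilities arbitrarily close to `0`, and by compactness the values converge along them. -/
theorem exists_limit_isOptimalPair [Finite S] {d : S → ℝ≥0∞} (hd : ∀ s, d s ≤ 1) :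
    ∃ (l : Filter ℕ) (α β : ℕ → ℝ≥0∞) (v : ℕ → S → ℝ≥0∞) (w : S → ℝ≥0∞) (c : G.MDStrategy),
      l.NeBot ∧ (∀ k, α k ≠ 0) ∧ (∀ k, α k + β k = 1) ∧ Tendsto v l (𝓝 w) ∧
      (∀ᶠ k in l, IsOptimalPair G d (α k) (β k) (v k) c) ∧ IsOptimalPair G d 0 1 w c := by
  set α : ℕ → ℝ≥0∞ := fun k => ((k : ℝ≥0∞) + 1)⁻¹ with hαdef
  set β : ℕ → ℝ≥0∞ := fun k => 1 - α k with hβdef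
  have hα0 (k) : α k ≠ 0 := by simp [hαdef]
  have hα1 (k) : α k ≤ 1 := by simp [hαdef]
  have hαβ (k) : α k + β k = 1 := add_tsub_cancel_of_le (hα1 k)
  have hα : Tendsto α atTop (𝓝 0) := by
    have := (tendsto_add_atTop_iff_nat 1).2 ENNReal.tendsto_inv_nat_nhds_zero
    simpa [hαdef] using this
  have hβ : Tendsto β atTop (𝓝 1) := by
    simpa using ENNReal.Tendsto.sub (tendsto_const_nhds (x := (1 : ℝ≥0∞))) hα (Or.inl (by simp))
  choose v c hvc using fun k => exists_isOptimalPair (G := G) hd (hαβ k)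
  -- along an ultrafilter the finitely valued `c` is eventually constant and `v` converges
  let l : Ultrafilter ℕ := hyperfilter ℕ
  have hl : (l : Filter ℕ) ≤ atTop := by
    rw [← Nat.cofinite_eq_atTop]; exact hyperfilter_le_cofinite
  obtain ⟨w, -, hw⟩ := isCompact_univ.ultrafilter_le_nhds' (l.map v) univ_mem
  obtain ⟨c', hc'⟩ : ∃ c', ∀ᶠ k in (l : Filter ℕ), c k = c' :=
    Ultrafilter.eventually_exists_iff.1 (Eventually.of_forall fun k => ⟨c k, rfl⟩)
  have hw : Tendsto v l (𝓝 w) := hw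
  have hev : ∀ᶠ k in (l : Filter ℕ), IsOptimalPair G d (α k) (β k) (v k) c' :=
    hc'.mono fun k hk => hk ▸ hvc k
  have hlim (s a) : Tendsto (fun k => d s * (α k + β k * G.nextValue (v k) (s, a))) l
      (𝓝 (d s * (0 + 1 * G.nextValue w (s, a)))) := by
    refine ENNReal.Tendsto.const_mul ((hα.mono_left hl).add ?_)
      (Or.inr ((hd s).trans_lt ENNReal.one_lt_top).ne)
    exact ENNReal.Tendsto.mul (hβ.mono_left hl) (Or.inl one_ne_zero) (tendsto_nextValue hw _)
      (Or.inr ENNReal.one_ne_top)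
  have hws (s) : Tendsto (fun k => v k s) l (𝓝 (w s)) := tendsto_pi_nhds.1 hw s
  refine ⟨l, α, β, v, w, c', l.neBot, hα0, hαβ, hw, hev, ?_, ?_, ?_, ?_⟩
  · exact fun s => le_of_tendsto (hws s) (hev.mono fun k h => h.le_one s)
  · exact fun s => tendsto_nhds_unique (hws s)
      ((hlim s _).congr' (hev.mono fun k h => (h.eq s).symm))
  · exact fun s hs a ha => le_of_tendsto_of_tendsto (hws s) (hlim s a)
      (hev.mono fun k h => h.le s hs a ha)
  · exact fun s hs a ha => le_of_tendsto_of_tendsto (hlim s a) (hws s)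
      (hev.mono fun k h => h.ge s hs a ha)

end Optimality

/-! ### The saddle point -/

section Saddle

variable {S A : Type*} {G : StochasticGame S A}

theorem plays_joint {σ τ : G.Strategy} {P : S → A → Prop}
    (hσ : ∀ s ∈ G.maxStates, ∀ h, ∀ a ∈ (σ.dist h s).support, P s a)
    (hτ : ∀ s ∉ G.maxStates, ∀ h, ∀ a ∈ (τ.dist h s).support, P s a) :
    (joint σ τ).Plays P := by
  intro h s a ha
  by_cases hs : s ∈ G.maxStates
  · exact hσ s hs h a (by simpa [joint, hs] using ha)
  · exact hτ s hs h a (by simpa [joint, hs] using ha)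

theorem MDStrategy.eq_act {c : G.MDStrategy} {h : List (S × A)} {s : S} {a : A}
    (ha : a ∈ (c.toStrategy.dist h s).support) : a = c.act s :=
  (PMF.mem_support_pure_iff _ _).1 ha

variable [Finite S] [Finite A] [MeasurableSpace S] [DiscreteMeasurableSpace S]
  [MeasurableSpace A] [DiscreteMeasurableSpace A]

theorem exists_utility_saddle (G : StochasticGame S A) (r : S → ℝ≥0) {b γ : ℝ} (hb : 1 < b)
    (hγ : 0 < γ) : ∃ c : G.MDStrategy, ∀ (σ τ : G.Strategy) (s : S),
      G.utility r b γ c.toStrategy τ s ≤ G.utility r b γ σ c.toStrategy s := by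
  have hd (s) : negExp b γ (r s) ≤ 1 := negExp_coe_le_one hb hγ _
  obtain ⟨l, α, β, v, w, c, hl, hα, hαβ, hvw, hv, hw⟩ := exists_limit_isOptimalPair (G := G) hd
  refine ⟨c, fun σ τ s => le_trans (b := w s) ?_ ?_⟩
  · refine ge_of_tendsto (tendsto_pi_nhds.1 hvw s) (hv.mono fun k hk => ?_)
    rw [utility_eq_iInf hb hγ]
    refine iInf_lintegral_weight_le (hα k) (hαβ k) hk.le_one (plays_joint ?_ ?_) s
    · intro s _ h a ha
      rw [MDStrategy.eq_act ha, ← hk.eq s]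
    · exact fun s hs h a ha => hk.ge s hs a (τ.support_subset h s ha)
  · rw [utility_eq_iInf hb hγ]
    refine le_iInf fun n => le_lintegral_weight hd hw.le_one (plays_joint ?_ ?_) s n
    · intro s hs h a ha
      simpa using hw.le s hs a (σ.support_subset h s ha)
    · intro s _ h a ha
      rw [MDStrategy.eq_act ha]
      simpa using (hw.eq s).le

end Saddle

end StochasticGame

/-- A saddle point of a payoff makes the game determined, with the coordinates of the saddle point
as optimal choices. -/
theorem minimax_of_saddle {I J L : Type*} [CompleteLattice L] {f : I → J → L} {i₀ : I} {j₀ : J}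
    (h : ∀ i j, f i₀ j ≤ f i j₀) :
    (⨅ i, ⨆ j, f i j) = f i₀ j₀ ∧ (⨆ j, ⨅ i, f i j) = f i₀ j₀ ∧
      (⨆ j, f i₀ j) = f i₀ j₀ ∧ (⨅ i, f i j₀) = f i₀ j₀ := by
  have h3 : (⨆ j, f i₀ j) = f i₀ j₀ := le_antisymm (iSup_le fun j => h i₀ j) (le_iSup (f i₀) j₀)
  have h4 : (⨅ i, f i j₀) = f i₀ j₀ :=
    le_antisymm (iInf_le (fun i => f i j₀) i₀) (le_iInf fun i => h i j₀)
  refine ⟨le_antisymm ((iInf_le _ i₀).trans_eq h3) ?_, le_antisymm ?_ ?_, h3, h4⟩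
  · exact h4.ge.trans (iInf_mono fun i => le_iSup (f i) j₀)
  · exact (iSup_mono fun j => iInf_le (fun i => f i j) i₀).trans_eq h3
  · exact h4.ge.trans (le_iSup (fun j => ⨅ i, f i j) j₀)

theorem mainTheorem1 {S A : Type*} [Finite S] [Finite A]
    [MeasurableSpace S] [DiscreteMeasurableSpace S]
    [MeasurableSpace A] [DiscreteMeasurableSpace A]
    (G : StochasticGame S A) (r : S → ℝ≥0) (b γ : ℝ) (hb : 1 < b) (hγ : 0 < γ) :
    -- both games are determined
    (∀ s : S, G.optERisk r b γ s =
      ⨅ τ : G.Strategy, ⨆ σ : G.Strategy, G.eRisk r b γ σ τ s) ∧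
    (∀ s : S, G.optUtility r b γ s =
      ⨆ τ : G.Strategy, ⨅ σ : G.Strategy, G.utility r b γ σ τ s) ∧
    -- Maximizer has an optimal memoryless deterministic strategy
    (∃ σ : G.MDStrategy, ∀ s : S,
      G.optERisk r b γ s = ⨅ τ : G.Strategy, G.eRisk r b γ σ.toStrategy τ s ∧
      G.optUtility r b γ s = ⨆ τ : G.Strategy, G.utility r b γ σ.toStrategy τ s) ∧
    -- Minimizer has an optimal memoryless deterministic strategy
    (∃ τ : G.MDStrategy, ∀ s : S,
      G.optERisk r b γ s = ⨆ σ : G.Strategy, G.eRisk r b γ σ τ.toStrategy s ∧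
      G.optUtility r b γ s = ⨅ σ : G.Strategy, G.utility r b γ σ τ.toStrategy s) := by
  obtain ⟨c, hc⟩ := G.exists_utility_saddle r hb hγ
  have hU (s : S) := minimax_of_saddle (i₀ := c.toStrategy) (j₀ := c.toStrategy)
    (f := fun σ τ => G.utility r b γ σ τ s) fun σ τ => hc σ τ s
  -- the order of the risks is the reverse of the order of the utilities
  have hE (s : S) := minimax_of_saddle (L := ERealᵒᵈ) (i₀ := c.toStrategy) (j₀ := c.toStrategy)
    (f := fun σ τ => OrderDual.toDual (G.eRisk r b γ σ τ s))
    fun σ τ => antitone_risk_of_utility hb hγ (hc σ τ s)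
  refine ⟨fun s => ?_, fun s => ?_, ⟨c, fun s => ⟨?_, ?_⟩⟩, ⟨c, fun s => ⟨?_, ?_⟩⟩⟩
  · exact (hE s).1.trans (hE s).2.1.symm
  · exact (hU s).1.trans (hU s).2.1.symm
  · exact (hE s).1.trans (hE s).2.2.1.symm
  · exact (hU s).1.trans (hU s).2.2.1.symm
  · exact (hE s).1.trans (hE s).2.2.2.symm
  · exact (hU s).1.trans (hU s).2.2.2.symm
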